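/- Let the integers $\xi_{n,i}$ ($n\ge 0$, $i\in\mathbb Z$) be defined by $\xi_{0,0}=1$, $\xi_{0,i}=0$ for $i\ne 0$, and $$\xi_{n+1,i}=(1+2n-6i)\,\xi_{n,i}+(n-2i+2)\,\xi_{n,i-1}-4(i+1)\,\xi_{n,i+1},$$ and let $\xi_n(x)=\sum_{i=0}^{\lfloor n/2\rfloor}\xi_{n,i}x^i$. (1) As formal power series in $z$, $$\sum_{n=0}^\infty \xi_n(x)\frac{z^n}{n!}=\frac{\sqrt{1+x}}{\sqrt{1+x}\,\cos(z\sqrt{1+x})-\sin(z\sqrt{1+x})}.$$ Here $x$ is any element with $1+x\neq 0$ of a field $K$ of characteristic $0$ that contains a square root $\sqrt{1+x}$ of $1+x$ (either root may be taken). In particular $x$ may be an indeterminate, or a real number $x>-1$. (2) $\xi_{n,0}=s_n$ for all $n\ge 0$, where $s_n$ is the $n$-th Springer number, that is, the number of snakes of rank $n$: signed permutations $\sigma=\sigma(1)\cdots\sigma(n)$ of $\{1,\dots,n\}$ (words in which $|\sigma(1)|,\dots,|\sigma(n)|$ is a permutation of $1,\dots,n$) such that $0<\sigma(1)>\sigma(2)<\sigma(3)>\cdots\sigma(n)$.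 (3) $\xi_{2n,n}=E_{2n}$ for all $n\ge 0$ and $\xi_{2n-1,n-1}=E_{2n}$ for all $n\ge 1$, where the secant number $E_{2n}$ is the number of alternating permutations of $\{1,\dots,2n\}$, that is, those with $\pi(1)>\pi(2)<\pi(3)>\cdots>\pi(2n)$. -/

import Mathlib

/-- The integers `ξ_{n,i}`, by their recurrence and initial conditions. The second index runs over
all integers. -/
def xi : ℕ → ℤ → ℤ
  | 0, i => if i = 0 then 1 else 0
  | n + 1, i =>
      (1 + 2 * (n : ℤ) - 6 * i) * xi n i + ((n : ℤ) - 2 * i + 2) * xi n (i - 1)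
        - 4 * (i + 1) * xi n (i + 1)

/-- The polynomial `ξ_n(x) = ∑_{i=0}^{⌊n/2⌋} ξ_{n,i} x^i`. -/
noncomputable def xiPoly (n : ℕ) : Polynomial ℤ :=
  ∑ i ∈ Finset.range (n / 2 + 1), Polynomial.C (xi n (i : ℤ)) * Polynomial.X ^ i

/-- The exponential generating function `ξ(x;z) = ∑ ξ_n(x) z^n / n!`, a formal power series in `z`,
at an element `x` of a field of characteristic zero. -/
noncomputable def xiEGF {K : Type*} [Field K] [CharZero K] (x : K) : PowerSeries K :=
  PowerSeries.mk fun n => Polynomial.aeval x (xiPoly n) / (n.factorial : K)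

/-- `π(1) > π(2) < π(3) > ⋯`. Positions are numbered from `0` here, so that an even `i` is an odd
position of the usual numbering. -/
def IsAlternatingPerm {n : ℕ} (π : Equiv.Perm (Fin n)) : Prop :=
  ∀ i j : Fin n, (j : ℕ) = (i : ℕ) + 1 →
    (Even (i : ℕ) → π j < π i) ∧ (Odd (i : ℕ) → π i < π j)

/-- The secant number `E_{2n}`: the number of alternating permutations in `𝔖_{2n}`. -/
noncomputable def secantNumber (n : ℕ) : ℕ :=
  Nat.card {π : Equiv.Perm (Fin (2 * n)) // IsAlternatingPerm π}

/-- Signed permutations of rank `n` (the underlying set of the hyperoctahedral group): a permutation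
`π` together with a sign for every position. -/
abbrev SignedPerm (n : ℕ) : Type := Equiv.Perm (Fin n) × (Fin n → ℤˣ)

/-- The word `σ(0) σ(1) ⋯ σ(n)` of a signed permutation, with `σ(0) = 0` and letters
`±1, …, ±n`. Outside `0, …, n` the value is irrelevant. -/
def SignedPerm.letter {n : ℕ} (σ : SignedPerm n) : ℕ → ℤ
  | 0 => 0
  | i + 1 => if h : i < n then (σ.2 ⟨i, h⟩ : ℤ) * (((σ.1 ⟨i, h⟩ : ℕ) : ℤ) + 1) else 0

/-- Snakes: `0 = σ(0) < σ(1) > σ(2) < σ(3) > ⋯ σ(n)`. -/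
def SignedPerm.IsSnake {n : ℕ} (σ : SignedPerm n) : Prop :=
  ∀ i < n, (Even i → σ.letter i < σ.letter (i + 1)) ∧ (Odd i → σ.letter (i + 1) < σ.letter i)

/-- The Springer number `s_n`: the number of snakes among the signed permutations of rank `n`. -/
noncomputable def springerNumber (n : ℕ) : ℕ :=
  Nat.card {σ : SignedPerm n // σ.IsSnake}

/-! Everything passes through the derivative polynomials Q_n = `secPoly n` of the secant. With s² =
1 + x one has ξ_n(s² - 1) = s^n Q_n(1/s): `xiPoly_comp_coeff` shows that the polynomial on the left
is the reversal of Q_n, because both obey the same coefficient recurrence. Taylor's formula applied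
to 1/(cos z - w sin z) gives ∑ Q_n(w) z^n/n! = 1/(cos z - w sin z) (`secPoly_egf_mul`). Putting w =
1/s and rescaling z by s yields (1). Also ξ_{n,0} = Q_n(1), and comparing top coefficients gives
ξ_{2n,n} = Q_{2n}(0).

On the combinatorial side, signed zigzag words are counted by a threshold t on the first letter.
Deleting the first letter gives boustrophedon recurrences, which force U cos z - V sin z = 1 for the
generating functions U, V of the words with σ(1) > 0 > ⋯-type start down and σ(1) ≤ 0 start up
(`boustrophedon_egf`). With all signs allowed, negation gives U = V, so U = 1/(cos z - sin z), the
series at w = 1. With positive signs only, V = 1, so U = sec z + tan z, whose even part is the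
series at w = 0. -/

/-- The derivative polynomials of the secant: `Q_n(tan z) sec z` is the `n`-th derivative of
`sec z`. -/
noncomputable def secPoly : ℕ → Polynomial ℤ
  | 0 => 1
  | n + 1 => Polynomial.X * secPoly n + (1 + Polynomial.X ^ 2) * (secPoly n).derivative

/-! ### Support and recurrences of ξ_n. -/

theorem xi_eq_zero_of_neg (n : ℕ) : ∀ i : ℤ, i < 0 → xi n i = 0 := by
  induction n with
  | zero => intro i hi; simp [xi, hi.ne]
  | succ n ih =>
    intro i hi
    rw [xi, ih i hi, ih (i - 1) (by omega)]
    rcases eq_or_ne i (-1) with rfl | h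
    · simp
    · rw [ih (i + 1) (by omega)]; simp

theorem xi_eq_zero_of_lt (n : ℕ) : ∀ i : ℤ, (n : ℤ) < 2 * i → xi n i = 0 := by
  induction n with
  | zero =>
    intro i hi
    have : i ≠ 0 := by rintro rfl; simp at hi
    simp [xi, this]
  | succ n ih =>
    intro i hi
    push_cast at hi
    rw [xi, ih i (by omega), ih (i + 1) (by omega)]
    -- On the boundary 2i = n + 2 the entry at i - 1 need not vanish, but its factor does.
    rcases eq_or_ne (2 * i) (n + 2) with h | h
    · have : (n : ℤ) - 2 * i + 2 = 0 := by omega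
      simp [this]
    · rw [ih (i - 1) (by omega)]; simp

theorem xiPoly_coeff (n i : ℕ) : (xiPoly n).coeff i = xi n i := by
  simp only [xiPoly, Polynomial.finsetSum_coeff, Polynomial.coeff_C_mul_X_pow]
  rw [Finset.sum_ite_eq]
  split_ifs with h
  · rfl
  · rw [Finset.mem_range] at h
    rw [xi_eq_zero_of_lt]
    omega

theorem xiPoly_natDegree_le (n : ℕ) : (xiPoly n).natDegree ≤ n / 2 := by
  rw [Polynomial.natDegree_le_iff_coeff_eq_zero]
  intro i hi
  rw [xiPoly_coeff, xi_eq_zero_of_lt]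
  omega

theorem xiPoly_zero : xiPoly 0 = 1 := by
  simp [xiPoly, xi]

theorem xiPoly_succ (n : ℕ) :
    xiPoly (n + 1) = (1 + (2 + Polynomial.X) * (n : Polynomial ℤ)) * xiPoly n
      - 2 * (Polynomial.X + 1) * (Polynomial.X + 2) * (xiPoly n).derivative := by
  have e : (1 + (2 + Polynomial.X) * (n : Polynomial ℤ)) * xiPoly n
      - 2 * (Polynomial.X + 1) * (Polynomial.X + 2) * (xiPoly n).derivative
      = Polynomial.C (1 + 2 * (n : ℤ)) * xiPoly n + Polynomial.C (n : ℤ) * (Polynomial.X * xiPoly n)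
        - Polynomial.C 2 * (Polynomial.X * (Polynomial.X * (xiPoly n).derivative))
        - Polynomial.C 6 * (Polynomial.X * (xiPoly n).derivative)
        - Polynomial.C 4 * (xiPoly n).derivative := by
    simp only [map_add, map_mul, map_one, map_natCast, map_ofNat]
    ring
  rw [e]
  ext i
  simp only [Polynomial.coeff_add, Polynomial.coeff_sub, Polynomial.coeff_C_mul]
  rw [xiPoly_coeff, xi]
  rcases i with _ | _ | i
  · simp [Polynomial.coeff_derivative, xiPoly_coeff, xi_eq_zero_of_neg]
  · simp [Polynomial.coeff_derivative, xiPoly_coeff, Polynomial.coeff_X_mul]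
    ring
  · simp only [Polynomial.coeff_derivative, xiPoly_coeff, Polynomial.coeff_X_mul]
    push_cast
    rw [show (i : ℤ) + 1 + 1 - 1 = i + 1 by ring]
    ring

/-- Under x = s² - 1 the chain rule turns 2(x+1)(x+2) d/dx into s(s²+1) d/ds. -/
theorem xiPoly_comp_succ (n : ℕ) :
    (xiPoly (n + 1)).comp (Polynomial.X ^ 2 - 1) =
      (xiPoly n).comp (Polynomial.X ^ 2 - 1) + (Polynomial.X ^ 2 + 1) *
        ((n : Polynomial ℤ) * (xiPoly n).comp (Polynomial.X ^ 2 - 1)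
          - Polynomial.X * ((xiPoly n).comp (Polynomial.X ^ 2 - 1)).derivative) := by
  rw [xiPoly_succ, Polynomial.derivative_comp]
  simp
  ring

/-! ### Reversal between ξ_n(s² - 1) and Q_n. -/

theorem secPoly_succ_coeff_zero (n : ℕ) : (secPoly (n + 1)).coeff 0 = (secPoly n).coeff 1 := by
  simp [secPoly, add_mul, Polynomial.mul_coeff_zero, Polynomial.coeff_derivative]

theorem secPoly_succ_coeff_succ (n k : ℕ) : (secPoly (n + 1)).coeff (k + 1) =
    (k + 1) * (secPoly n).coeff k + (k + 2) * (secPoly n).coeff (k + 2) := by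
  rw [secPoly, add_mul, one_mul, pow_two, mul_assoc, Polynomial.coeff_add, Polynomial.coeff_add,
    Polynomial.coeff_X_mul, Polynomial.coeff_X_mul, Polynomial.coeff_derivative]
  rcases k with _ | k
  · simp
    ring
  · rw [Polynomial.coeff_X_mul, Polynomial.coeff_derivative]
    push_cast
    ring

theorem secPoly_natDegree_le (n : ℕ) : (secPoly n).natDegree ≤ n := by
  induction n with
  | zero => simp [secPoly]
  | succ n ih =>
    rw [Polynomial.natDegree_le_iff_coeff_eq_zero] at ih ⊢
    intro i hi
    obtain ⟨i, rfl⟩ : ∃ j, i = j + 1 := ⟨i - 1, by omega⟩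
    rw [secPoly_succ_coeff_succ, ih i (by omega), ih (i + 2) (by omega)]
    simp

theorem xiPoly_comp_natDegree_le (n : ℕ) :
    ((xiPoly n).comp (Polynomial.X ^ 2 - 1)).natDegree ≤ n := by
  refine Polynomial.natDegree_comp_le.trans ?_
  have h : (Polynomial.X ^ 2 - 1 : Polynomial ℤ).natDegree ≤ 2 := by compute_degree
  calc _ ≤ n / 2 * 2 := Nat.mul_le_mul (xiPoly_natDegree_le n) h
    _ ≤ n := Nat.div_mul_le_self n 2

theorem xiPoly_comp_succ_coeff (n m : ℕ) :
    ((xiPoly (n + 1)).comp (Polynomial.X ^ 2 - 1)).coeff m =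
      (n + 1 - m) * ((xiPoly n).comp (Polynomial.X ^ 2 - 1)).coeff m
        + if 2 ≤ m then (n + 2 - m) * ((xiPoly n).comp (Polynomial.X ^ 2 - 1)).coeff (m - 2)
          else 0 := by
  rw [xiPoly_comp_succ]
  set R := (xiPoly n).comp (Polynomial.X ^ 2 - 1)
  have e : R + (Polynomial.X ^ 2 + 1) * ((n : Polynomial ℤ) * R - Polynomial.X * R.derivative)
      = R + Polynomial.C (n : ℤ) * R - Polynomial.X * R.derivative
        + (Polynomial.C (n : ℤ) * R - Polynomial.X * R.derivative) * Polynomial.X ^ 2 := by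
    simp only [map_natCast]
    ring
  have hX (i : ℕ) : (Polynomial.X * R.derivative).coeff i = i * R.coeff i := by
    rcases i with _ | i
    · simp
    · rw [Polynomial.coeff_X_mul, Polynomial.coeff_derivative]
      push_cast
      ring
  rw [e, Polynomial.coeff_add, Polynomial.coeff_mul_X_pow']
  simp only [Polynomial.coeff_add, Polynomial.coeff_sub, Polynomial.coeff_C_mul, hX]
  split_ifs with h
  · push_cast [h]
    ring
  · ring

theorem xiPoly_comp_coeff (n : ℕ) : ∀ m k : ℕ, m + k = n →
    ((xiPoly n).comp (Polynomial.X ^ 2 - 1)).coeff m = (secPoly n).coeff k := by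
  induction n with
  | zero =>
    intro m k h
    obtain ⟨rfl, rfl⟩ : m = 0 ∧ k = 0 := by omega
    simp [xiPoly_zero, secPoly]
  | succ n ih =>
    intro m k h
    have hQ (i : ℕ) (hi : n < i) : (secPoly n).coeff i = 0 :=
      Polynomial.coeff_eq_zero_of_natDegree_lt ((secPoly_natDegree_le n).trans_lt hi)
    rw [xiPoly_comp_succ_coeff]
    rcases k with _ | k
    · obtain rfl : m = n + 1 := h
      rw [secPoly_succ_coeff_zero]
      split_ifs with h2
      · rw [ih (n + 1 - 2) 1 (by omega)]
        push_cast
        ring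
      · rw [hQ 1 (by omega)]
        push_cast
        ring
    · obtain rfl : n = m + k := by omega
      rw [secPoly_succ_coeff_succ, ih m k rfl]
      split_ifs with h2
      · rw [ih (m - 2) (k + 2) (by omega)]
        push_cast
        ring
      · rw [hQ (k + 2) (by omega)]
        push_cast
        ring

theorem aeval_xiPoly {K : Type*} [Field K] (n : ℕ) (x s : K) (hx : s ^ 2 = 1 + x) (hs : s ≠ 0) :
    Polynomial.aeval x (xiPoly n) = s ^ n * Polynomial.aeval s⁻¹ (secPoly n) := by
  have h1 : Polynomial.aeval x (xiPoly n)
      = Polynomial.aeval s ((xiPoly n).comp (Polynomial.X ^ 2 - 1)) := by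
    rw [Polynomial.aeval_comp]
    congr 2
    simp [hx]
  rw [h1, Polynomial.aeval_eq_sum_range' (Nat.lt_succ_of_le (xiPoly_comp_natDegree_le n)),
    Polynomial.aeval_eq_sum_range' (Nat.lt_succ_of_le (secPoly_natDegree_le n)),
    ← Finset.sum_range_reflect, Finset.mul_sum]
  refine Finset.sum_congr rfl fun k hk => ?_
  have hk' : k ≤ n := by simpa [Nat.lt_succ_iff] using hk
  rw [show n.succ - 1 - k = n - k by omega, xiPoly_comp_coeff n (n - k) k (by omega),
    mul_smul_comm, inv_pow, pow_sub₀ s hs hk']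

theorem xi_two_mul (n : ℕ) : xi (2 * n) n = (secPoly (2 * n)).coeff 0 := by
  rw [← xiPoly_comp_coeff (2 * n) (2 * n) 0 rfl, ← xiPoly_coeff]
  have hd : (xiPoly (2 * n)).natDegree < n + 1 := by
    have := xiPoly_natDegree_le (2 * n)
    omega
  have h2 : (Polynomial.X ^ 2 - 1 : Polynomial ℤ).natDegree ≤ 2 := by compute_degree
  rw [Polynomial.comp, Polynomial.eval₂_eq_sum_range' _ hd, Polynomial.finsetSum_coeff,
    Finset.sum_range_succ, Finset.sum_eq_zero, zero_add, Polynomial.coeff_C_mul, mul_comm 2 n,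
    Polynomial.coeff_pow_of_natDegree_le h2]
  · simp [Polynomial.coeff_one]
  · intro i hi
    have h3 := Polynomial.natDegree_pow_le_of_le i h2
    have h4 := Finset.mem_range.1 hi
    have h5 : ((Polynomial.X ^ 2 - 1 : Polynomial ℤ) ^ i).natDegree < n * 2 := by omega
    rw [Polynomial.coeff_C_mul, mul_comm 2 n, Polynomial.coeff_eq_zero_of_natDegree_lt h5, mul_zero]

/-- In the recurrence for `xi (2 * n) n` two terms lie outside the support, and the remaining
coefficient is 1. -/
theorem xi_two_mul_sub_one (n : ℕ) (hn : 1 ≤ n) :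
    xi (2 * n - 1) ((n : ℤ) - 1) = xi (2 * n) n := by
  obtain ⟨m, rfl⟩ : ∃ m, n = m + 1 := ⟨n - 1, by omega⟩
  rw [show 2 * (m + 1) = 2 * m + 1 + 1 by ring, Nat.add_sub_cancel, xi.eq_2 _ (2 * m + 1),
    xi_eq_zero_of_lt _ (((m + 1 : ℕ) : ℤ)) (by push_cast; omega),
    xi_eq_zero_of_lt _ (((m + 1 : ℕ) : ℤ) + 1) (by push_cast; omega)]
  push_cast
  rw [add_sub_cancel_right]
  ring

/-! ### Formal sine and cosine, and the generating function of Q_n. -/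

section TrigSeries

open PowerSeries

theorem derivative_sin (K : Type*) [Field K] [CharZero K] :
    d⁄dX K (PowerSeries.sin K) = PowerSeries.cos K := by
  ext n
  rw [coeff_derivative, PowerSeries.sin, PowerSeries.cos, coeff_mk, coeff_mk]
  have h : (n : K) + 1 ≠ 0 := by exact_mod_cast n.succ_ne_zero
  rcases Nat.even_or_odd n with hn | hn
  · have h1 : ¬ Even (n + 1) := by simpa [Nat.even_add_one] using hn
    rw [if_neg h1, if_pos hn, show (n + 1) / 2 = n / 2 by obtain ⟨k, rfl⟩ := hn; omega]
    simp [Nat.factorial_succ]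
    field_simp
  · have h1 : Even (n + 1) := by simpa [Nat.even_add_one] using hn
    rw [if_pos h1, if_neg (by simpa using hn), zero_mul]

theorem derivative_cos (K : Type*) [Field K] [CharZero K] :
    d⁄dX K (PowerSeries.cos K) = -PowerSeries.sin K := by
  ext n
  rw [coeff_derivative, map_neg, PowerSeries.sin, PowerSeries.cos, coeff_mk, coeff_mk]
  have h : (n : K) + 1 ≠ 0 := by exact_mod_cast n.succ_ne_zero
  rcases Nat.even_or_odd n with hn | hn
  · have h1 : ¬ Even (n + 1) := by simpa [Nat.even_add_one] using hn
    rw [if_neg h1, if_pos hn]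
    simp
  · have h1 : Even (n + 1) := by simpa [Nat.even_add_one] using hn
    rw [if_pos h1, if_neg (by simpa using hn),
      show (n + 1) / 2 = n / 2 + 1 by obtain ⟨k, rfl⟩ := hn; omega]
    simp [Nat.factorial_succ, pow_succ]
    field_simp

theorem constantCoeff_sin (K : Type*) [Field K] [CharZero K] :
    constantCoeff (PowerSeries.sin K) = 0 := by
  simp [PowerSeries.sin, ← coeff_zero_eq_constantCoeff_apply]

theorem constantCoeff_cos (K : Type*) [Field K] [CharZero K] :
    constantCoeff (PowerSeries.cos K) = 1 := by
  simp [PowerSeries.cos, ← coeff_zero_eq_constantCoeff_apply]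

theorem secPoly_egf_mul {K : Type*} [Field K] [CharZero K] (w : K) :
    (PowerSeries.mk fun n => Polynomial.aeval w (secPoly n) / (n.factorial : K))
      * (PowerSeries.cos K - C w * PowerSeries.sin K) = 1 := by
  set D : PowerSeries K := PowerSeries.cos K - C w * PowerSeries.sin K with hD
  set N : PowerSeries K := PowerSeries.sin K + C w * PowerSeries.cos K with hN
  have hD0 : constantCoeff D = 1 := by simp [hD, constantCoeff_sin, constantCoeff_cos]
  have hN0 : constantCoeff N = w := by simp [hN, constantCoeff_sin, constantCoeff_cos]
  have hDD : d⁄dX K D = -N := by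
    simp [hD, hN, derivative_sin, derivative_cos]
    ring
  have hND : d⁄dX K N = D := by
    simp [hD, hN, derivative_sin, derivative_cos]
    ring
  have hinv : D * D⁻¹ = 1 := PowerSeries.mul_inv_cancel D (by simp [hD0])
  -- N/D plays the role of tan(z + arctan w): its derivative is 1 + (N/D)², while (1/D)' =
  -- (1/D)(N/D), which reproduces the recurrence of Q_n.
  have key (n : ℕ) : (d⁄dX K)^[n] D⁻¹ = D⁻¹ * Polynomial.aeval (N * D⁻¹) (secPoly n) := by
    induction n with
    | zero => simp [secPoly]
    | succ n ih =>
      rw [Function.iterate_succ_apply', ih, Derivation.leibniz]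
      have ht : d⁄dX K (N * D⁻¹) = 1 + (N * D⁻¹) ^ 2 := by
        rw [Derivation.leibniz, derivative_inv', hDD, hND]
        simp only [smul_eq_mul]
        linear_combination hinv
      have hq : d⁄dX K (Polynomial.aeval (N * D⁻¹) (secPoly n))
          = Polynomial.aeval (N * D⁻¹) (secPoly n).derivative * (1 + (N * D⁻¹) ^ 2) := by
        have := ((d⁄dX K).restrictScalars ℤ).map_aeval (secPoly n) (N * D⁻¹)
        simp only [Derivation.restrictScalars_apply, smul_eq_mul] at this
        rw [this, ht]
      rw [hq, derivative_inv', hDD, secPoly]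
      simp only [smul_eq_mul, map_add, map_mul, map_one, map_pow, Polynomial.aeval_X]
      ring
  have hG : (PowerSeries.mk fun n => Polynomial.aeval w (secPoly n) / (n.factorial : K)) = D⁻¹ := by
    ext n
    have h := constantCoeff_iterate_derivative D⁻¹ n
    have hc : constantCoeff (Polynomial.aeval (N * D⁻¹) (secPoly n))
        = Polynomial.aeval w (secPoly n) := by
      rw [Polynomial.aeval_def, Polynomial.hom_eval₂, Polynomial.aeval_def]
      simp [hN0, hD0]
      congr 1
    rw [key, map_mul, hc] at h
    simp [hD0] at h
    have hf : (n.factorial : K) ≠ 0 := by exact_mod_cast n.factorial_ne_zero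
    rw [coeff_mk, h]
    field_simp
  rw [hG, mul_comm, hinv]

end TrigSeries

theorem xiEGF_eq {K : Type*} [Field K] [CharZero K] (x s : K) (hx : s ^ 2 = 1 + x) (hs : s ≠ 0) :
    xiEGF x = PowerSeries.C s *
      (PowerSeries.C s * PowerSeries.rescale s (PowerSeries.cos K)
        - PowerSeries.rescale s (PowerSeries.sin K))⁻¹ := by
  have h : xiEGF x = PowerSeries.rescale s
      (PowerSeries.mk fun n => Polynomial.aeval s⁻¹ (secPoly n) / (n.factorial : K)) := by
    ext n
    rw [xiEGF, PowerSeries.coeff_rescale, PowerSeries.coeff_mk, PowerSeries.coeff_mk,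
      aeval_xiPoly n x s hx hs, mul_div_assoc]
  have h2 := congrArg (PowerSeries.rescale s) (secPoly_egf_mul s⁻¹)
  have hC (a : K) : PowerSeries.rescale s (PowerSeries.C a) = PowerSeries.C a := by
    ext n
    rcases n with _ | n <;> simp [PowerSeries.coeff_rescale, PowerSeries.coeff_C]
  rw [map_mul, ← h, map_sub, map_mul, map_one, hC] at h2
  have hr (f : PowerSeries K) : PowerSeries.constantCoeff (PowerSeries.rescale s f)
      = PowerSeries.constantCoeff f := by
    rw [← PowerSeries.coeff_zero_eq_constantCoeff_apply, PowerSeries.coeff_rescale]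
    simp
  rw [PowerSeries.eq_mul_inv_iff_mul_eq (by
    simp [hr, constantCoeff_sin, constantCoeff_cos, hs])]
  have hss : PowerSeries.C s * PowerSeries.C s⁻¹ = (1 : PowerSeries K) := by
    rw [← map_mul, mul_inv_cancel₀ hs, map_one]
  linear_combination PowerSeries.C s * h2
    + xiEGF x * PowerSeries.rescale s (PowerSeries.sin K) * hss

/-! ### Zigzag words and deletion of the first letter. -/

/-- The first `n` letters of `w` alternate; they start with a descent if `e` is even and with an
ascent if `e` is odd. -/
def IsZigzag (n e : ℕ) (w : ℕ → ℤ) : Prop :=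
  ∀ i, i + 1 < n → (Even (i + e) → w (i + 1) < w i) ∧ (Odd (i + e) → w i < w (i + 1))

theorem isZigzag_add_two {n e : ℕ} {w : ℕ → ℤ} : IsZigzag n (e + 2) w ↔ IsZigzag n e w := by
  simp only [IsZigzag, ← add_assoc, Nat.even_add, Nat.odd_add, even_two, iff_true]

theorem isZigzag_succ {n e : ℕ} {w : ℕ → ℤ} : IsZigzag (n + 1) e w ↔
    (0 < n → (Even e → w 1 < w 0) ∧ (Odd e → w 0 < w 1)) ∧
      IsZigzag n (e + 1) (fun i => w (i + 1)) := by
  constructor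
  · intro h
    refine ⟨fun hn => by simpa using h 0 (by omega), fun i hi => ?_⟩
    have := h (i + 1) (by omega)
    rwa [add_assoc, add_comm 1 e] at this
  · rintro ⟨h0, h⟩ i hi
    rcases i with _ | i
    · simpa using h0 (by omega)
    · have := h i (by omega)
      rwa [add_comm e 1, ← add_assoc] at this

/-- The increasing relabelling of the integers that frees the two letters `±(p + 1)`. -/
def skipLetter (p : ℕ) (x : ℤ) : ℤ :=
  if (p : ℤ) + 1 ≤ x then x + 1 else if x ≤ -((p : ℤ) + 1) then x - 1 else x

theorem skipLetter_lt_iff (p : ℕ) {x y : ℤ} : skipLetter p x < skipLetter p y ↔ x < y := by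
  unfold skipLetter
  split_ifs <;> omega

theorem skipLetter_le_iff (p : ℕ) {x : ℤ} : skipLetter p x ≤ p ↔ x ≤ p := by
  unfold skipLetter
  split_ifs <;> omega

theorem lt_skipLetter_iff (p : ℕ) {x : ℤ} : (p : ℤ) + 1 < skipLetter p x ↔ (p : ℤ) < x := by
  unfold skipLetter
  split_ifs <;> omega

namespace SignedPerm

theorem letter_succ {n : ℕ} (σ : SignedPerm n) (i : Fin n) :
    σ.letter (i + 1) = (σ.2 i : ℤ) * (((σ.1 i : ℕ) : ℤ) + 1) := by
  simp [letter]

theorem letter_one {n : ℕ} (σ : SignedPerm (n + 1)) :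
    σ.letter 1 = (σ.2 0 : ℤ) * (((σ.1 0 : ℕ) : ℤ) + 1) :=
  letter_succ σ 0

theorem letter_succ_ne_zero {n : ℕ} (σ : SignedPerm n) {i : ℕ} (hi : i < n) :
    σ.letter (i + 1) ≠ 0 := by
  rw [letter_succ σ ⟨i, hi⟩]
  exact mul_ne_zero (Units.ne_zero _) (by omega)

theorem letter_succ_le {n : ℕ} (σ : SignedPerm n) {i : ℕ} (hi : i < n) :
    σ.letter (i + 1) ≤ n := by
  rw [letter_succ σ ⟨i, hi⟩]
  have := (σ.1 ⟨i, hi⟩).2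
  rcases Int.units_eq_one_or (σ.2 ⟨i, hi⟩) with h | h <;> rw [h] <;> push_cast <;> omega

/-- Prefix the letter `s (p + 1)` to a signed permutation, relabelling its letters. -/
def cons {n : ℕ} (p : Fin (n + 1)) (s : ℤˣ) (τ : SignedPerm n) : SignedPerm (n + 1) :=
  (((finSuccEquiv' 0).trans (Equiv.optionCongr τ.1)).trans (finSuccEquiv' p).symm, Fin.cons s τ.2)

theorem cons_fst_zero {n : ℕ} (p : Fin (n + 1)) (s : ℤˣ) (τ : SignedPerm n) :
    (cons p s τ).1 0 = p := by
  simp [cons]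

theorem cons_fst_succ {n : ℕ} (p : Fin (n + 1)) (s : ℤˣ) (τ : SignedPerm n) (i : Fin n) :
    (cons p s τ).1 i.succ = p.succAbove (τ.1 i) := by
  have h : finSuccEquiv' 0 i.succ = some i := by
    rw [← Fin.succAbove_zero, finSuccEquiv'_succAbove]
  simp [cons, h]

theorem cons_letter_one {n : ℕ} (p : Fin (n + 1)) (s : ℤˣ) (τ : SignedPerm n) :
    (cons p s τ).letter 1 = s * (((p : ℕ) : ℤ) + 1) := by
  rw [letter_one, cons_fst_zero]
  rfl

theorem cons_letter_add_two {n : ℕ} (p : Fin (n + 1)) (s : ℤˣ) (τ : SignedPerm n) {i : ℕ}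
    (hi : i < n) : (cons p s τ).letter (i + 2) = skipLetter p (τ.letter (i + 1)) := by
  have h := letter_succ (cons p s τ) (Fin.succ ⟨i, hi⟩)
  rw [cons_fst_succ] at h
  rw [letter_succ τ ⟨i, hi⟩]
  have h2 : (cons p s τ).2 (Fin.succ ⟨i, hi⟩) = τ.2 ⟨i, hi⟩ := rfl
  rw [h2] at h
  refine h.trans ?_
  set a := τ.1 ⟨i, hi⟩
  have ha : ((p.succAbove a : Fin (n + 1)) : ℕ) = if (a : ℕ) < p then (a : ℕ) else a + 1 := by
    rw [Fin.succAbove]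
    split_ifs <;> simp_all [Fin.lt_def]
  rw [ha, skipLetter]
  rcases Int.units_eq_one_or (τ.2 ⟨i, hi⟩) with h | h <;> rw [h] <;> push_cast <;>
    split_ifs <;> omega

theorem cons_injective {n : ℕ} : Function.Injective
    fun x : Fin (n + 1) × ℤˣ × SignedPerm n => cons x.1 x.2.1 x.2.2 := by
  rintro ⟨p, s, τ⟩ ⟨q, r, ρ⟩ h
  simp only at h
  have h1 := congrArg Prod.fst h
  have h2 : (Fin.cons s τ.2 : Fin (n + 1) → ℤˣ) = Fin.cons r ρ.2 := congrArg Prod.snd h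
  obtain ⟨hs, hτ⟩ := Fin.cons_inj.1 h2
  obtain rfl : p = q := by
    rw [← cons_fst_zero p s τ, h1, cons_fst_zero]
  have h3 : τ.1 = ρ.1 := by
    ext i : 1
    apply Fin.succAbove_right_injective (p := p)
    rw [← cons_fst_succ p s τ, h1, cons_fst_succ]
  rw [hs, Prod.ext h3 hτ]

/-- Surjectivity follows from injectivity, since both sides have 2^(n+1) (n+1)! elements. -/
theorem exists_cons {n : ℕ} (σ : SignedPerm (n + 1)) : ∃ p s τ, σ = cons p s τ := by
  have hb := (Fintype.bijective_iff_injective_and_card _).2 ⟨cons_injective (n := n), by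
    simp [Fintype.card_perm, Nat.factorial_succ, pow_succ]
    ring⟩
  obtain ⟨⟨p, s, τ⟩, h⟩ := hb.2 σ
  exact ⟨p, s, τ, h.symm⟩

open Classical in
theorem card_letter_one_eq {n : ℕ} (p : Fin (n + 1)) (A : SignedPerm (n + 1) → Prop) :
    (Finset.univ.filter fun σ : SignedPerm (n + 1) => σ.letter 1 = ((p : ℕ) : ℤ) + 1 ∧ A σ).card =
      (Finset.univ.filter fun τ : SignedPerm n => A (cons p 1 τ)).card := by
  have hinj : Function.Injective (cons p 1 : SignedPerm n → SignedPerm (n + 1)) := fun τ ρ h => by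
    have := @cons_injective n (p, 1, τ) (p, 1, ρ) h
    simpa using this
  rw [← Finset.card_image_of_injective _ hinj]
  congr 1
  ext σ
  simp only [Finset.mem_filter, Finset.mem_univ, true_and, Finset.mem_image]
  constructor
  · rintro ⟨h1, hA⟩
    obtain ⟨q, s, τ, rfl⟩ := exists_cons σ
    rw [cons_letter_one] at h1
    have : s = 1 ∧ q = p := by
      rcases Int.units_eq_one_or s with rfl | rfl
      · refine ⟨rfl, Fin.ext ?_⟩
        push_cast at h1
        omega
      · push_cast at h1
        omega
    obtain ⟨rfl, rfl⟩ := this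
    exact ⟨τ, hA, rfl⟩
  · rintro ⟨τ, hA, rfl⟩
    exact ⟨by simp [cons_letter_one], hA⟩

theorem isZigzag_cons {n e : ℕ} (p : Fin (n + 1)) (s : ℤˣ) (τ : SignedPerm n) :
    IsZigzag (n + 1) e (fun i => (cons p s τ).letter (i + 1)) ↔
      (0 < n → (Even e → skipLetter p (τ.letter 1) < s * (((p : ℕ) : ℤ) + 1)) ∧
        (Odd e → s * (((p : ℕ) : ℤ) + 1) < skipLetter p (τ.letter 1))) ∧
      IsZigzag n (e + 1) (fun i => τ.letter (i + 1)) := by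
  rw [isZigzag_succ]
  refine and_congr (imp_congr_right fun hn => ?_) (forall_congr' fun i => imp_congr_right fun hi => ?_)
  · rw [show (cons p s τ).letter (1 + 1) = _ from cons_letter_add_two p s τ hn]
    rw [show (cons p s τ).letter (0 + 1) = _ from cons_letter_one p s τ]
  · simp only [show (cons p s τ).letter (i + 1 + 1) = _ from cons_letter_add_two p s τ (by omega),
      show (cons p s τ).letter (i + 1 + 1 + 1) = _ from
        cons_letter_add_two p s τ (i := i + 1) (by omega), skipLetter_lt_iff]

/-! ### Boustrophedon counts. -/

/-- Words with signs in `P`, with `t < σ(1) > σ(2) < ⋯`. -/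
def IsAbove (P : ℤˣ → Prop) {n : ℕ} (t : ℕ) (σ : SignedPerm n) : Prop :=
  (∀ i, P (σ.2 i)) ∧ (0 < n → (t : ℤ) < σ.letter 1) ∧ IsZigzag n 0 (fun i => σ.letter (i + 1))

/-- Words with signs in `P`, with `t ≥ σ(1) < σ(2) > ⋯`. -/
def IsBelow (P : ℤˣ → Prop) {n : ℕ} (t : ℕ) (σ : SignedPerm n) : Prop :=
  (∀ i, P (σ.2 i)) ∧ (0 < n → σ.letter 1 ≤ (t : ℤ)) ∧ IsZigzag n 1 (fun i => σ.letter (i + 1))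

open Classical in
/-- The number of signed permutations of rank `n` that satisfy `IsAbove P t`. -/
noncomputable def numAbove (P : ℤˣ → Prop) (n t : ℕ) : ℕ :=
  (Finset.univ.filter fun σ : SignedPerm n => IsAbove P t σ).card

open Classical in
/-- The number of signed permutations of rank `n` that satisfy `IsBelow P t`. -/
noncomputable def numBelow (P : ℤˣ → Prop) (n t : ℕ) : ℕ :=
  (Finset.univ.filter fun σ : SignedPerm n => IsBelow P t σ).card

theorem forall_cons_snd {P : ℤˣ → Prop} {n : ℕ} (p : Fin (n + 1)) (s : ℤˣ) (τ : SignedPerm n) :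
    (∀ i, P ((cons p s τ).2 i)) ↔ P s ∧ ∀ i, P (τ.2 i) := by
  rw [Fin.forall_fin_succ]
  rfl

/-- Either σ(1) > t + 1 or σ(1) = t + 1. In the second case deleting σ(1) turns σ(2) < t + 1 into a
relabelled first letter ≤ t. -/
theorem numAbove_succ {P : ℤˣ → Prop} (hP : P 1) {n t : ℕ} (ht : t ≤ n) :
    numAbove P (n + 1) t = numAbove P (n + 1) (t + 1) + numBelow P n t := by
  classical
  have h := card_letter_one_eq (⟨t, by omega⟩ : Fin (n + 1)) (IsAbove P t)
  have h2 (τ : SignedPerm n) : IsAbove P t (cons ⟨t, by omega⟩ 1 τ) ↔ IsBelow P t τ := by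
    simp [IsAbove, IsBelow, forall_cons_snd, isZigzag_cons, cons_letter_one, hP,
      skipLetter_le_iff]
  simp only [h2] at h
  rw [numBelow, ← h, numAbove, numAbove, ← Finset.card_union_of_disjoint]
  · congr 1
    ext σ
    simp only [Finset.mem_filter, Finset.mem_univ, true_and, Finset.mem_union]
    simp only [IsAbove]
    push_cast
    constructor
    · rintro ⟨h1, h3, h4⟩
      have h3 := h3 (by omega)
      by_cases h5 : σ.letter 1 = t + 1
      · exact Or.inr ⟨h5, h1, fun _ => h3, h4⟩
      · exact Or.inl ⟨h1, fun _ => by omega, h4⟩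
    · rintro (⟨h1, h3, h4⟩ | ⟨-, h⟩)
      · exact ⟨h1, fun hn => by have := h3 hn; omega, h4⟩
      · exact h
  · rw [Finset.disjoint_filter]
    rintro σ - ⟨-, h3, -⟩ ⟨h5, -⟩
    have := h3 (by omega)
    push_cast at *
    omega

theorem numBelow_succ {P : ℤˣ → Prop} (hP : P 1) {n t : ℕ} (ht : t ≤ n) :
    numBelow P (n + 1) (t + 1) = numBelow P (n + 1) t + numAbove P n t := by
  classical
  have h := card_letter_one_eq (⟨t, by omega⟩ : Fin (n + 1)) (IsBelow P (t + 1))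
  have h2 (τ : SignedPerm n) : IsBelow P (t + 1) (cons ⟨t, by omega⟩ 1 τ) ↔ IsAbove P t τ := by
    simp [IsAbove, IsBelow, forall_cons_snd, isZigzag_cons, cons_letter_one, hP,
      lt_skipLetter_iff, isZigzag_add_two (e := 0)]
  simp only [h2] at h
  rw [numAbove, ← h, numBelow, numBelow, ← Finset.card_union_of_disjoint]
  · congr 1
    ext σ
    simp only [Finset.mem_filter, Finset.mem_univ, true_and, Finset.mem_union]
    simp only [IsBelow]
    push_cast
    constructor
    · rintro ⟨h1, h3, h4⟩
      have h3 := h3 (by omega)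
      by_cases h5 : σ.letter 1 = t + 1
      · exact Or.inr ⟨h5, h1, fun _ => h3, h4⟩
      · exact Or.inl ⟨h1, fun _ => by omega, h4⟩
    · rintro (⟨h1, h3, h4⟩ | ⟨-, h⟩)
      · exact ⟨h1, fun hn => by have := h3 hn; omega, h4⟩
      · exact h
  · rw [Finset.disjoint_filter]
    rintro σ - ⟨-, h3, -⟩ ⟨h5, -⟩
    have := h3 (by omega)
    omega

theorem numAbove_self {P : ℤˣ → Prop} {n : ℕ} (hn : 0 < n) : numAbove P n n = 0 := by
  classical
  rw [numAbove, Finset.card_eq_zero, Finset.filter_eq_empty_iff]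
  rintro σ - ⟨-, h, -⟩
  have h1 := h hn
  have h2 := letter_succ_le σ hn
  rw [zero_add] at h2
  omega

theorem numAbove_zero_zero (P : ℤˣ → Prop) : numAbove P 0 0 = 1 := by
  classical
  rw [numAbove, Finset.filter_true_of_mem]
  · simp
  · intro σ _
    exact ⟨fun i => i.elim0, fun h => by omega, fun i h => by omega⟩

theorem numBelow_zero_zero (P : ℤˣ → Prop) : numBelow P 0 0 = 1 := by
  classical
  rw [numBelow, Finset.filter_true_of_mem]
  · simp
  · intro σ _
    exact ⟨fun i => i.elim0, fun h => by omega, fun i h => by omega⟩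

theorem numBelow_eq_one_zero {n : ℕ} (hn : 0 < n) : numBelow (· = 1) n 0 = 0 := by
  classical
  rw [numBelow, Finset.card_eq_zero, Finset.filter_eq_empty_iff]
  rintro σ - ⟨h, h1, -⟩
  have h2 := h1 hn
  have h3 := letter_succ σ ⟨0, hn⟩
  rw [h] at h3
  simp at h3
  omega

/-- Change the signs of all letters. -/
def neg {n : ℕ} : SignedPerm n ≃ SignedPerm n :=
  (Equiv.refl _).prodCongr (Equiv.neg _)

theorem neg_letter {n : ℕ} (σ : SignedPerm n) (i : ℕ) : (neg σ).letter i = -σ.letter i := by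
  rcases i with _ | i
  · simp [letter]
  · simp only [letter]
    split_ifs <;> simp [neg]

/-- Negation reverses every inequality; ≤ 0 and < 0 agree because letters are nonzero. -/
theorem numBelow_true_zero (n : ℕ) : numBelow (fun _ => True) n 0 = numAbove (fun _ => True) n 0 := by
  classical
  rw [numBelow, numAbove]
  refine Finset.card_equiv neg fun σ => ?_
  simp only [Finset.mem_filter, Finset.mem_univ, true_and]
  simp only [IsAbove, IsBelow, neg_letter, IsZigzag]
  refine and_congr (by simp) (and_congr (imp_congr_right fun hn => ?_)
    (forall_congr' fun i => imp_congr_right fun hi => ?_))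
  · have := letter_succ_ne_zero σ hn
    rw [zero_add] at this
    push_cast
    omega
  · rw [neg_lt_neg_iff, neg_lt_neg_iff, add_zero, Nat.even_add_one, Nat.odd_add_one,
      Nat.not_even_iff_odd, Nat.not_odd_iff_even]
    exact and_comm

theorem isSnake_iff {n : ℕ} (σ : SignedPerm n) : σ.IsSnake ↔ IsAbove (fun _ => True) 0 σ := by
  -- The letter σ(0) = 0 is treated as the start of a zigzag of length n + 1, then split off.
  have h : σ.IsSnake ↔ IsZigzag (n + 1) 1 σ.letter := by
    simp only [IsSnake, IsZigzag, Nat.add_lt_add_iff_right, Nat.even_add_one, Nat.odd_add_one,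
      Nat.not_even_iff_odd, Nat.not_odd_iff_even]
    exact forall_congr' fun i => imp_congr_right fun hi => and_comm
  rw [h, isZigzag_succ, isZigzag_add_two (e := 0), IsAbove]
  simp [letter.eq_1]

theorem springerNumber_eq (n : ℕ) : springerNumber n = numAbove (fun _ => True) n 0 := by
  classical
  rw [springerNumber, Nat.card_eq_fintype_card, Fintype.card_subtype, numAbove]
  simp only [isSnake_iff]

theorem isAbove_eq_one_iff {n : ℕ} (σ : SignedPerm n) :
    IsAbove (· = 1) 0 σ ↔ σ.2 = 1 ∧ IsAlternatingPerm σ.1 := by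
  have h0 : (∀ i, σ.2 i = 1) ↔ σ.2 = 1 := funext_iff.symm
  rw [IsAbove, h0]
  refine and_congr_right fun h1 => ?_
  have hl (i : ℕ) (hi : i < n) : σ.letter (i + 1) = ((σ.1 ⟨i, hi⟩ : ℕ) : ℤ) + 1 := by
    rw [letter_succ σ ⟨i, hi⟩, h1]
    simp
  constructor
  · rintro ⟨-, h⟩ ⟨i, hi⟩ ⟨j, hj⟩ (rfl : j = i + 1)
    have := h i hj
    simp only [hl i hi, hl (i + 1) hj, add_zero] at this
    simp only [Fin.lt_def]
    refine ⟨fun he => ?_, fun ho => ?_⟩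
    · have := this.1 he; omega
    · have := this.2 ho; omega
  · intro h
    refine ⟨fun hn => ?_, fun i hi => ?_⟩
    · have := hl 0 hn
      rw [zero_add] at this
      rw [this]
      push_cast
      omega
    · have := h ⟨i, by omega⟩ ⟨i + 1, hi⟩ rfl
      simp only [Fin.lt_def] at this
      simp only [hl i (by omega), hl (i + 1) hi, add_zero]
      refine ⟨fun he => ?_, fun ho => ?_⟩
      · have := this.1 he; omega
      · have := this.2 ho; omega

theorem secantNumber_eq (n : ℕ) : secantNumber n = numAbove (· = 1) (2 * n) 0 := by
  classical
  rw [secantNumber, Nat.card_eq_fintype_card, Fintype.card_subtype, numAbove]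
  refine Finset.card_nbij' (fun π => (π, 1)) Prod.fst ?_ ?_ ?_ ?_
  · intro π hπ
    simpa [isAbove_eq_one_iff] using hπ
  · intro σ hσ
    have := (isAbove_eq_one_iff σ).1 (by simpa using hσ)
    simpa using this.2
  · intro π _
    rfl
  · intro σ hσ
    have := (isAbove_eq_one_iff σ).1 (by simpa using hσ)
    exact Prod.ext rfl this.1.symm

end SignedPerm

/-! ### From boustrophedon recurrences to series. -/

section BoustrophedonSeries

open PowerSeries

theorem boustrophedon_egf {K : Type*} [Field K] [CharZero K] (A B : ℕ → ℕ → K)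
    (hA : ∀ n t, t ≤ n → A (n + 1) (t + 1) = A (n + 1) t - B n t)
    (hB : ∀ n t, t ≤ n → B (n + 1) (t + 1) = B (n + 1) t + A n t)
    (h0 : A 0 0 = 1) (hd : ∀ n, 0 < n → A n n = 0) :
    (PowerSeries.mk fun n => A n 0 / (n.factorial : K)) * PowerSeries.cos K
      - (PowerSeries.mk fun n => B n 0 / (n.factorial : K)) * PowerSeries.sin K = 1 := by
  -- Shifting rank and threshold together turns the recurrences into a_t' = a_{t+1} + b_t and b_t' =
  -- b_{t+1} - a_t. Hence the t-th derivative of a_0 cos - b_0 sin is a_t cos - b_t sin, with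
  -- constant term A t t.
  let a (t : ℕ) : PowerSeries K := PowerSeries.mk fun n => A (n + t) t / (n.factorial : K)
  let b (t : ℕ) : PowerSeries K := PowerSeries.mk fun n => B (n + t) t / (n.factorial : K)
  have hfac (n : ℕ) : (n.factorial : K) ≠ 0 := by exact_mod_cast n.factorial_ne_zero
  have hn (n : ℕ) : (n : K) + 1 ≠ 0 := by exact_mod_cast n.succ_ne_zero
  have ha (t : ℕ) : d⁄dX K (a t) = a (t + 1) + b t := by
    ext n
    have h := hA (n + t) t (by omega)
    simp only [a, b, coeff_derivative, coeff_mk, map_add, Nat.factorial_succ]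
    rw [← add_assoc n t 1, h, show n + 1 + t = n + t + 1 by ring]
    have := hfac n
    have := hn n
    push_cast
    field_simp
    ring
  have hb (t : ℕ) : d⁄dX K (b t) = b (t + 1) - a t := by
    ext n
    have h := hB (n + t) t (by omega)
    simp only [a, b, coeff_derivative, coeff_mk, map_sub, Nat.factorial_succ]
    rw [← add_assoc n t 1, h, show n + 1 + t = n + t + 1 by ring]
    have := hfac n
    have := hn n
    push_cast
    field_simp
    ring
  have key (t : ℕ) : (d⁄dX K)^[t] (a 0 * PowerSeries.cos K - b 0 * PowerSeries.sin K)
      = a t * PowerSeries.cos K - b t * PowerSeries.sin K := by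
    induction t with
    | zero => rfl
    | succ t ih =>
      rw [Function.iterate_succ_apply', ih, map_sub, Derivation.leibniz, Derivation.leibniz,
        derivative_cos, derivative_sin, ha, hb]
      simp only [smul_eq_mul]
      ring
  change a 0 * PowerSeries.cos K - b 0 * PowerSeries.sin K = 1
  ext t
  have h := constantCoeff_iterate_derivative
    (a 0 * PowerSeries.cos K - b 0 * PowerSeries.sin K) t
  have h1 : constantCoeff (a t) = A t t := by
    simp [a, ← coeff_zero_eq_constantCoeff_apply]
  rw [key, map_sub, map_mul, map_mul, constantCoeff_cos, constantCoeff_sin, h1] at h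
  rw [coeff_one]
  rcases Nat.eq_zero_or_pos t with rfl | ht
  · simpa [h0] using h.symm
  · rw [hd t ht] at h
    rw [if_neg ht.ne']
    simpa [hfac t] using h

end BoustrophedonSeries

theorem numAbove_egf {P : ℤˣ → Prop} (hP : P 1) :
    (PowerSeries.mk fun n => (SignedPerm.numAbove P n 0 : ℚ) / (n.factorial : ℚ))
        * PowerSeries.cos ℚ
      - (PowerSeries.mk fun n => (SignedPerm.numBelow P n 0 : ℚ) / (n.factorial : ℚ))
        * PowerSeries.sin ℚ = 1 := by
  refine boustrophedon_egf (fun n t => (SignedPerm.numAbove P n t : ℚ))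
    (fun n t => (SignedPerm.numBelow P n t : ℚ)) ?_ ?_ ?_ ?_
  · intro n t ht
    simp only [SignedPerm.numAbove_succ hP ht, Nat.cast_add, add_sub_cancel_right]
  · intro n t ht
    simp only [SignedPerm.numBelow_succ hP ht, Nat.cast_add]
  · simp [SignedPerm.numAbove_zero_zero]
  · intro n hn
    simp [SignedPerm.numAbove_self hn]

/-! ### Identification with Springer and secant numbers. -/

theorem xi_zero_eq_springerNumber (n : ℕ) : xi n 0 = springerNumber n := by
  have h1 := secPoly_egf_mul (1 : ℚ)
  have h2 := numAbove_egf (P := fun _ => True) trivial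
  simp only [SignedPerm.numBelow_true_zero] at h2
  rw [map_one, one_mul] at h1
  rw [← mul_sub] at h2
  have hD : (PowerSeries.cos ℚ - PowerSeries.sin ℚ) ≠ 0 := right_ne_zero_of_mul (h1 ▸ one_ne_zero)
  have h3 := congrArg (PowerSeries.coeff n) (mul_right_cancel₀ hD (h1.trans h2.symm))
  have hf : (n.factorial : ℚ) ≠ 0 := by exact_mod_cast n.factorial_ne_zero
  rw [PowerSeries.coeff_mk, PowerSeries.coeff_mk, div_left_inj' hf,
    ← SignedPerm.springerNumber_eq] at h3
  have h4 := aeval_xiPoly n (0 : ℚ) 1 (by norm_num) one_ne_zero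
  rw [one_pow, one_mul, inv_one, h3, ← Polynomial.coeff_zero_eq_aeval_zero', xiPoly_coeff, eq_intCast] at h4
  exact_mod_cast h4

theorem xi_two_mul_eq_secantNumber (n : ℕ) : xi (2 * n) n = secantNumber n := by
  have h1 := secPoly_egf_mul (0 : ℚ)
  have h2 := numAbove_egf (P := (· = 1)) rfl
  rw [map_zero, zero_mul, sub_zero] at h1
  set G : PowerSeries ℚ := PowerSeries.mk fun n =>
    Polynomial.aeval (0 : ℚ) (secPoly n) / (n.factorial : ℚ) with hG
  set u : PowerSeries ℚ := PowerSeries.mk fun n =>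
    (SignedPerm.numAbove (· = 1) n 0 : ℚ) / (n.factorial : ℚ) with hu
  have hd : (PowerSeries.mk fun n =>
      (SignedPerm.numBelow (· = 1) n 0 : ℚ) / (n.factorial : ℚ)) = 1 := by
    ext n
    rw [PowerSeries.coeff_mk, PowerSeries.coeff_one]
    rcases Nat.eq_zero_or_pos n with rfl | hn
    · simp [SignedPerm.numBelow_zero_zero]
    · simp [SignedPerm.numBelow_eq_one_zero hn, hn.ne']
  rw [hd, one_mul] at h2
  have hc : PowerSeries.rescale (-1) (PowerSeries.cos ℚ) = PowerSeries.cos ℚ := by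
    ext n
    rw [PowerSeries.coeff_rescale, PowerSeries.cos, PowerSeries.coeff_mk]
    split_ifs with h
    · rw [h.neg_one_pow, one_mul]
    · rw [mul_zero]
  have hs : PowerSeries.rescale (-1) (PowerSeries.sin ℚ) = -PowerSeries.sin ℚ := by
    ext n
    rw [PowerSeries.coeff_rescale, map_neg, PowerSeries.sin, PowerSeries.coeff_mk]
    split_ifs with h
    · rw [mul_zero, neg_zero]
    · rw [(Nat.not_even_iff_odd.1 h).neg_one_pow, neg_one_mul]
  -- Adding the relation at -z to the one at z cancels the sine and isolates the even part of `u`.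
  have h3 := congrArg (PowerSeries.rescale (-1 : ℚ)) h2
  rw [map_sub, map_mul, map_one, hc, hs] at h3
  have hD : PowerSeries.cos ℚ ≠ 0 := right_ne_zero_of_mul (h1 ▸ one_ne_zero)
  have hGc : G * PowerSeries.cos ℚ = 1 := h1
  have h4 : u + PowerSeries.rescale (-1) u = 2 * G :=
    mul_right_cancel₀ hD (by rw [mul_assoc, hGc]; linear_combination h2 + h3)
  have h5 := congrArg (PowerSeries.coeff (2 * n)) h4
  have hf : ((2 * n).factorial : ℚ) ≠ 0 := by exact_mod_cast (2 * n).factorial_ne_zero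
  rw [two_mul G, map_add, map_add, PowerSeries.coeff_rescale, (even_two_mul n).neg_one_pow, one_mul,
    hu, hG, PowerSeries.coeff_mk, PowerSeries.coeff_mk, ← add_div, ← add_div, div_left_inj' hf,
    ← SignedPerm.secantNumber_eq, ← Polynomial.coeff_zero_eq_aeval_zero', ← xi_two_mul, eq_intCast] at h5
  have h6 : ((secantNumber n : ℤ) : ℚ) + ((secantNumber n : ℤ) : ℚ)
      = (xi (2 * n) n : ℚ) + (xi (2 * n) n : ℚ) := by exact_mod_cast h5
  have h7 : ((xi (2 * n) n : ℤ) : ℚ) = ((secantNumber n : ℤ) : ℚ) := by linarith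
  exact_mod_cast h7

theorem mainTheorem10 :
    (∀ (K : Type*) [Field K] [CharZero K] (x s : K), s ^ 2 = 1 + x → s ≠ 0 →
      xiEGF x =
        PowerSeries.C s *
          (PowerSeries.C s * PowerSeries.rescale s (PowerSeries.cos K)
            - PowerSeries.rescale s (PowerSeries.sin K))⁻¹) ∧
    (∀ n : ℕ, xi n 0 = (springerNumber n : ℤ)) ∧
    (∀ n : ℕ, xi (2 * n) (n : ℤ) = (secantNumber n : ℤ)) ∧
    (∀ n : ℕ, 1 ≤ n → xi (2 * n - 1) ((n : ℤ) - 1) = (secantNumber n : ℤ)) :=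
  ⟨fun _ _ _ x s hx hs => xiEGF_eq x s hx hs, xi_zero_eq_springerNumber,
    xi_two_mul_eq_secantNumber,
    fun n hn => (xi_two_mul_sub_one n hn).trans (xi_two_mul_eq_secantNumber n)⟩
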